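/- A metric graph $\mathcal G$ has a vertex set $V$, a subset $V_\infty\subset V$ of vertices at infinity, and a set $E$ of edges; loops and multiple edges are allowed, and $\mathcal G$ is connected. Each vertex in $V_\infty$ has degree one. An edge $e$ ending at a vertex in $V_\infty$ is identified with the halfline $I_e=[0,+\infty)$, where $0$ corresponds to its other endpoint, which is not in $V_\infty$; every other edge joins vertices outside $V_\infty$ and is identified with an interval $I_e=[0,\ell_e]$, $0<\ell_e<\infty$. The graph is called non-compact if it contains at least one halfline (if $E$ is finite, this is equivalent to the non-compactness of the space obtained by gluing the intervals $I_e$ at the common vertices). The space $H^1(\mathcal G)$ consists of the families $u=(u_e)_{e\in E}$ of functions $u_e\in H^1(I_e;\mathbb C)$ (continuous representatives) such that $\sum_{e}\|u_e\|_{H^1(I_e)}^2<\infty$ and $u$ is continuous at every vertex not in $V_\infty$, that is, endpoints of edges that are located at the same such vertex carry the same value of $u$. For $u\in H^1(\mathcal G)$ let $$E(u,\mathcal G)=\frac12\sum_{e\in E}\int_{I_e}|u_e'|^2\,dx-\frac14\sum_{e\in E}\int_{I_e}|u_e|^4\,dx ,$$ and for $\mu>0$ let $$\mathcal E_{\mathcal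 G}(\mu)=\inf\Big\{E(u,\mathcal G)\;:\;u\in H^1(\mathcal G),\ \sum_{e\in E}\int_{I_e}|u_e|^2\,dx=\mu\Big\}.$$ **Proposition (Pinching).** For every non-compact metric graph $\mathcal G$ and every mass $\mu>0$, $$-\frac{\mu^3}{24}\ \le\ \mathcal E_{\mathcal G}(\mu)\ \le\ -\frac{\mu^3}{96}.$$ -/

import Mathlib

open MeasureTheory
open scoped ENNReal

/-- A connected metric graph with vertex set `V` (vertices at infinity included) and edge set `E`.
Loops and multiple edges are allowed. Each edge `e` carries an orientation, from `src e` to `tgt e`,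
and a length in `(0, ∞]`. An edge is a halfline exactly when it ends at a vertex at infinity;
halflines are oriented from their finite endpoint towards infinity. -/
structure MetricGraph (V E : Type*) where
  /-- initial vertex of an edge (coordinate `0`) -/
  src : E → V
  /-- final vertex of an edge (coordinate `length e`, or `+∞` on a halfline) -/
  tgt : E → V
  /-- length of an edge -/
  length : E → ℝ≥0∞
  /-- the set of vertices at infinity -/
  atInfinity : Set V
  length_pos : ∀ e, 0 < length e
  /-- the halflines are the edges that end at a vertex at infinity -/
  length_eq_top_iff : ∀ e, length e = ⊤ ↔ tgt e ∈ atInfinity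
  /-- no edge starts at infinity; in particular no edge joins two vertices at infinity -/
  src_notMem : ∀ e, src e ∉ atInfinity
  /-- every vertex at infinity has degree one -/
  degree_one : ∀ v ∈ atInfinity, ∃! e, tgt e = v
  connected : ∀ v w, Relation.EqvGen (fun a b => ∃ e, src e = a ∧ tgt e = b) v w

namespace MetricGraph

variable {V E : Type*}

/-- The real interval `I_e`: `[0, ℓ_e]`, or `[0, +∞)` if `e` is a halfline. -/
def interval (G : MetricGraph V E) (e : E) : Set ℝ :=
  {x : ℝ | 0 ≤ x ∧ ENNReal.ofReal x ≤ G.length e}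

/-- A graph is non-compact if it contains at least one halfline. For finitely many edges this is
the non-compactness of the underlying topological space, see `isNoncompact_iff`. -/
def IsNoncompact (G : MetricGraph V E) : Prop :=
  ∃ e, G.length e = ⊤

/-- `‖v‖_{L^q(G)}^q = ∑_e ∫_{I_e} |v_e|^q` for a function `v = (v_e)_e` on the graph. -/
noncomputable def normPow (G : MetricGraph V E) (q : ℕ) (v : E → ℝ → ℂ) : ℝ :=
  ∑' e, ∫ x in G.interval e, ‖v e x‖ ^ q

/-- The gradient of `u`: on the edge `e` it is `u_e'`. -/
noncomputable def grad (u : E → ℝ → ℂ) : E → ℝ → ℂ :=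
  fun e => deriv (u e)

/-- The Sobolev space `H¹(G)`. A function `u` on the graph is a family `(u_e)_e`, where only the
values of `u_e` on `I_e` matter. Membership of `u_e` in `H¹(I_e)` means that `u_e` is (the
continuous representative which is) absolutely continuous on bounded intervals, so that `u_e'`
exists almost everywhere, with `u_e` and `u_e'` in `L²(I_e)`. The squared `H¹`-norms must be
summable over the edges, and `u` must be continuous at every vertex. -/
structure MemH1 (G : MetricGraph V E) (u : E → ℝ → ℂ) : Prop where
  absolutelyContinuous : ∀ e, ∀ a ∈ G.interval e, ∀ b ∈ G.interval e,
    AbsolutelyContinuousOnInterval (u e) a b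
  memLp : ∀ e, MemLp (u e) 2 (volume.restrict (G.interval e))
  memLp_grad : ∀ e, MemLp (grad u e) 2 (volume.restrict (G.interval e))
  summable : Summable fun e => ∫ x in G.interval e, ‖u e x‖ ^ 2
  summable_grad : Summable fun e => ∫ x in G.interval e, ‖grad u e x‖ ^ 2
  continuous_at_vertices : ∃ w : V → ℂ, (∀ e, u e 0 = w (G.src e)) ∧
    ∀ e, G.length e ≠ ⊤ → u e (G.length e).toReal = w (G.tgt e)

/-- The space `H¹_μ(G)` of the functions of mass `μ`, the mass being `‖u‖²_{L²(G)}`. -/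
def massConstraint (G : MetricGraph V E) (μ : ℝ) : Set (E → ℝ → ℂ) :=
  {u | G.MemH1 u ∧ G.normPow 2 u = μ}

/-- The energy `E(u, G) = 1/2 ‖∇u‖²_{L²(G)} - 1/4 ‖u‖⁴_{L⁴(G)}`. -/
noncomputable def energy (G : MetricGraph V E) (u : E → ℝ → ℂ) : ℝ :=
  1 / 2 * G.normPow 2 (grad u) - 1 / 4 * G.normPow 4 u

/-- The constrained ground-state energy `inf {E(u, G) : u ∈ H¹_μ(G)}`, as an extended real number:
it is `⊥` if the constrained energy is unbounded from below, `⊤` if there is no competitor. -/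
noncomputable def groundEnergy (G : MetricGraph V E) (μ : ℝ) : EReal :=
  ⨅ u ∈ G.massConstraint μ, (G.energy u : EReal)

section Space

/-- `p` is an endpoint of its edge, located at the vertex `v`. -/
def IsAt (G : MetricGraph V E) (p : Σ e, G.interval e) (v : V) : Prop :=
  ((p.2 : ℝ) = 0 ∧ G.src p.1 = v) ∨
    (G.length p.1 ≠ ⊤ ∧ (p.2 : ℝ) = (G.length p.1).toReal ∧ G.tgt p.1 = v)

/-- The topological space underlying a metric graph: the disjoint union of the intervals `I_e`,
with endpoints at the same vertex glued together. -/
def Space (G : MetricGraph V E) : Type _ :=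
  Quot fun p q : Σ e, G.interval e => ∃ v, G.IsAt p v ∧ G.IsAt q v

instance (G : MetricGraph V E) : TopologicalSpace G.Space :=
  inferInstanceAs (TopologicalSpace (Quot _))

/-- With finitely many edges, a graph contains a halfline if and only if it is non-compact. -/
theorem isNoncompact_iff [Finite E] (G : MetricGraph V E) :
    G.IsNoncompact ↔ NoncompactSpace G.Space := by
  classical
  constructor
  · rintro ⟨e, he⟩
    rw [← not_compactSpace_iff]
    intro hc
    let F : (Σ e, G.interval e) → ℝ := fun p => if p.1 = e then (p.2 : ℝ) else 0
    have hFc : Continuous F := by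
      refine continuous_sigma fun e' => ?_
      by_cases h : e' = e
      · simpa [F, h] using continuous_subtype_val
      · simpa [F, h] using continuous_const
    have hF0 : ∀ p v, G.IsAt p v → F p = 0 := by
      rintro ⟨e', x⟩ v h
      by_cases h' : e' = e
      · subst h'
        rcases h with h | h
        · simpa [F] using h.1
        · exact absurd he h.1
      · simp [F, h']
    let f : G.Space → ℝ := Quot.lift F (by
      rintro p q ⟨v, hp, hq⟩
      rw [hF0 p v hp, hF0 q v hq])
    have hf : Continuous f := continuous_quot_lift _ hFc
    obtain ⟨C, hC⟩ := (isCompact_range hf).bddAbove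
    have hx : max C 0 + 1 ∈ G.interval e := ⟨by positivity, by simp [he]⟩
    let y : G.Space := Quot.mk _ ⟨e, ⟨_, hx⟩⟩
    have h1 : f y ≤ C := hC (Set.mem_range_self y)
    have h2 : f y = max C 0 + 1 := by
      change F ⟨e, ⟨_, hx⟩⟩ = _
      simp [F]
    have := le_max_left C 0
    linarith
  · intro h
    by_contra hn
    have hK : ∀ e, CompactSpace (G.interval e) := by
      intro e
      have he : G.length e ≠ ⊤ := fun he => hn ⟨e, he⟩
      have : G.interval e = Set.Icc 0 (G.length e).toReal := by
        ext x
        simp only [interval, Set.mem_ofPred_eq, Set.mem_Icc]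
        exact and_congr_right fun _ => ENNReal.ofReal_le_iff_le_toReal he
      rw [this]
      infer_instance
    have : CompactSpace G.Space :=
      inferInstanceAs (CompactSpace (Quot fun p q : Σ e, G.interval e =>
        ∃ v, G.IsAt p v ∧ G.IsAt q v))
    exact not_compactSpace_iff.mpr h this

end Space

end MetricGraph

/-! Lower bound, without rearrangement. A path joins any point `y` to a halfline, along which `u`
comes arbitrarily close to zero. So `|u|²` takes every value in `(0, |u(y)|²]` on the graph.
Truncating `|u|` at the level `|u(y)|` and comparing lengths of images gives `|u(y)|² ≤ 2 ∫ |u'|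
|u|` over `{|u| < |u(y)|}` (`enorm_sq_le_tsum`). Multiply this by `|u(y)|²`, integrate in `y` and
exchange the integrals: `∫ |u|⁴ ≤ 2 ∫ |u'| |u| N`, where `N(x)` is the mass of `u` on `{|u| >
|u(x)|}`. By Young's inequality it remains to bound `∫ |u|² N²`. This is the measure, for the cube
of the mass distribution, of the triples in which `|u|` is strictly smallest at the first point,
hence by symmetry at most `μ³ / 3`. Both steps hold on any s-finite measure space
(`six_mul_lintegral_pow_four_le`); the graph enters only through the pointwise bound. Upper bound. A
soliton on a halfline, joined linearly to zero at the finite endpoint and extended by zero, is a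
competitor after normalization of its mass. As it escapes to infinity, its energy tends to that of
the soliton of mass `μ` on the line, `-μ³ / 96`. -/

theorem Set.uIoc_subset_uIoc_union_uIoc (a b c : ℝ) :
    Set.uIoc a c ⊆ Set.uIoc a b ∪ Set.uIoc b c := by
  intro x hx
  simp only [Set.mem_union, Set.mem_uIoc] at *
  grind

theorem ENNReal.two_mul_mul_le_sq_add_sq (a b : ℝ≥0∞) : 2 * (a * b) ≤ a ^ 2 + b ^ 2 := by
  wlog h : a ≤ b generalizing a b
  · rw [mul_comm a b, add_comm (a ^ 2)]
    exact this b a (le_of_not_ge h)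
  obtain ⟨c, rfl⟩ := exists_add_of_le h
  calc 2 * (a * (a + c)) ≤ 2 * (a * (a + c)) + c ^ 2 := le_self_add
    _ = a ^ 2 + (a + c) ^ 2 := by ring

/-! ### The level-set inequality on a measure space -/

namespace MeasureTheory

variable {X : Type*} [MeasurableSpace X]

/-- The superlevel masses `N x = ν {y | f x < f y}` of a function `f` satisfy
`3 ∫ N² dν ≤ ν(X)³`. -/
theorem three_mul_lintegral_measure_superlevel_sq_le (ν : Measure X) [SFinite ν] {f : X → ℝ≥0∞}
    (hf : Measurable f) :
    3 * ∫⁻ x, ν {y | f x < f y} ^ 2 ∂ν ≤ ν Set.univ ^ 3 := by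
  classical
  let k : X → X → ℝ≥0∞ := fun x y => if f x < f y then 1 else 0
  have hk : ∀ {Y : Type _} [MeasurableSpace Y] {p q : Y → X}, Measurable p → Measurable q →
      Measurable fun t => k (p t) (q t) := fun hp hq =>
    Measurable.ite (measurableSet_lt (hf.comp hp) (hf.comp hq)) measurable_const measurable_const
  have hN : ∀ x, ν {y | f x < f y} = ∫⁻ y, k x y ∂ν := fun x => by
    rw [← lintegral_indicator_one (measurableSet_lt measurable_const hf)]
    simp [k, Set.indicator_apply]
  -- `F x y z` indicates that `f` is strictly smallest at `x`, and the square of the superlevel mass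
  -- is its integral over `y` and `z`. By Tonelli, moving the minimum to another variable does not
  -- change the triple integral; the three indicators exclude one another, so their sum is at most
  -- `1`.
  let F : X → X → X → ℝ≥0∞ := fun x y z => k x y * k x z
  have hF : ∀ {Y : Type _} [MeasurableSpace Y] {p q r : Y → X}, Measurable p → Measurable q →
      Measurable r → Measurable fun t => F (p t) (q t) (r t) := fun hp hq hr =>
    (hk hp hq).mul (hk hp hr)
  set I := ∫⁻ x, ∫⁻ y, ∫⁻ z, F x y z ∂ν ∂ν ∂ν with hI
  have hNI : ∫⁻ x, ν {y | f x < f y} ^ 2 ∂ν = I := by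
    refine lintegral_congr fun x => ?_
    have hx : Measurable (k x) := hk measurable_const measurable_id
    rw [hN, sq, ← lintegral_mul_const _ hx]
    exact lintegral_congr fun y => (lintegral_const_mul _ hx).symm
  have h2 : ∫⁻ x, ∫⁻ y, ∫⁻ z, F y x z ∂ν ∂ν ∂ν = I := by
    rw [lintegral_lintegral_swap]
    exact (Measurable.lintegral_prod_right
      (hF measurable_fst.snd measurable_fst.fst measurable_snd)).aemeasurable
  have h3 : ∫⁻ x, ∫⁻ y, ∫⁻ z, F z x y ∂ν ∂ν ∂ν = I := by
    calc _ = ∫⁻ x, ∫⁻ z, ∫⁻ y, F z x y ∂ν ∂ν ∂ν := by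
          refine lintegral_congr fun x => ?_
          rw [lintegral_lintegral_swap]
          exact (hF measurable_snd measurable_const measurable_fst).aemeasurable
      _ = I := by
          rw [lintegral_lintegral_swap]
          exact (Measurable.lintegral_prod_right
            (hF measurable_fst.snd measurable_fst.fst measurable_snd)).aemeasurable
  have hsum : ∫⁻ x, ∫⁻ y, ∫⁻ z, (F x y z + F y x z + F z x y) ∂ν ∂ν ∂ν = 3 * I := by
    have : (3 : ℝ≥0∞) * I = I + I + I := by ring
    rw [this]
    conv_rhs =>
      congr
      · rw [hI]; arg 2; rw [← hI, ← h2]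
      · rw [← h3]
    rw [← lintegral_add_left, ← lintegral_add_left]
    · refine lintegral_congr fun x => ?_
      rw [← lintegral_add_left, ← lintegral_add_left]
      · refine lintegral_congr fun y => ?_
        rw [lintegral_add_left, lintegral_add_left]
        · exact hF measurable_const measurable_const measurable_id
        · exact (hF measurable_const measurable_const measurable_id).add
            (hF measurable_const measurable_const measurable_id)
      · exact (Measurable.lintegral_prod_right
            (hF measurable_const measurable_fst measurable_snd)).add
          (Measurable.lintegral_prod_right (hF measurable_fst measurable_const measurable_snd))
      · exact Measurable.lintegral_prod_right (hF measurable_const measurable_fst measurable_snd)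
    · exact (Measurable.lintegral_prod_right (Measurable.lintegral_prod_right
          (hF measurable_fst.fst measurable_fst.snd measurable_snd))).add
        (Measurable.lintegral_prod_right (Measurable.lintegral_prod_right
          (hF measurable_fst.snd measurable_fst.fst measurable_snd)))
    · exact Measurable.lintegral_prod_right (Measurable.lintegral_prod_right
          (hF measurable_fst.fst measurable_fst.snd measurable_snd))
  rw [hNI, ← hsum]
  calc _ ≤ ∫⁻ _, ∫⁻ _, ∫⁻ _, 1 ∂ν ∂ν ∂ν := by
        refine lintegral_mono fun x => lintegral_mono fun y => lintegral_mono fun z => ?_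
        simp only [F, k]
        rcases lt_trichotomy (f x) (f y) with h | h | h <;>
        rcases lt_trichotomy (f x) (f z) with h' | h' | h' <;>
        rcases lt_trichotomy (f y) (f z) with h'' | h'' | h'' <;>
        simp [h, h.le, h', h'.le, h'', h''.le, not_lt_of_ge]
    _ = ν Set.univ ^ 3 := by
        simp only [lintegral_const]
        ring

/-- If `f y² / 2` is at most the integral of `g f` over the sublevel set `{f < f y}` for all `y`,
then `1/4 ∫ f⁴ ≤ 1/2 ∫ g² + 1/24 (∫ f²)³`. -/
theorem six_mul_lintegral_pow_four_le (m : Measure X) [SFinite m] {f g : X → ℝ≥0∞}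
    (hf : Measurable f) (hg : Measurable g)
    (h : ∀ y, f y ^ 2 ≤ 2 * ∫⁻ x, {x | f x < f y}.indicator (fun x => g x * f x) x ∂m) :
    6 * ∫⁻ x, f x ^ 4 ∂m ≤ 12 * ∫⁻ x, g x ^ 2 ∂m + (∫⁻ x, f x ^ 2 ∂m) ^ 3 := by
  classical
  set ν := m.withDensity fun x => f x ^ 2 with hν
  let N : X → ℝ≥0∞ := fun x => ν {y | f x < f y}
  have hNm : Measurable N := by
    have : MeasurableSet {p : X × X | f p.1 < f p.2} :=
      measurableSet_lt (hf.comp measurable_fst) (hf.comp measurable_snd)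
    exact measurable_measure_prodMk_left this
  have hNi : ∀ x, N x = ∫⁻ y, {y | f x < f y}.indicator (fun y => f y ^ 2) y ∂m := fun x => by
    have := measurableSet_lt (measurable_const (a := f x)) hf
    rw [lintegral_indicator this, ← withDensity_apply _ this]
  have h3 : 3 * ∫⁻ x, (f x * N x) ^ 2 ∂m ≤ (∫⁻ x, f x ^ 2 ∂m) ^ 3 := by
    have := three_mul_lintegral_measure_superlevel_sq_le ν hf
    rw [withDensity_apply _ MeasurableSet.univ, Measure.restrict_univ] at this
    refine le_trans (le_of_eq ?_) this
    rw [hν, lintegral_withDensity_eq_lintegral_mul _ (hf.pow_const 2) (hNm.pow_const 2)]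
    simp [N, mul_pow]
  -- The hypothesis is weighted by `f y ^ 2`; after the exchange of integrals, the inner one over
  -- `{y | f x < f y}` is `N x`.
  have h1 : ∫⁻ x, f x ^ 4 ∂m ≤ 2 * ∫⁻ x, g x * (f x * N x) ∂m := by
    calc ∫⁻ y, f y ^ 4 ∂m
        ≤ ∫⁻ y, 2 * ∫⁻ x, f y ^ 2 * {x | f x < f y}.indicator (fun x => g x * f x) x ∂m ∂m := by
          refine lintegral_mono fun y => ?_
          have hy : Measurable ({x | f x < f y}.indicator fun x => g x * f x) :=
            (hg.mul hf).indicator (measurableSet_lt hf measurable_const)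
          rw [lintegral_const_mul _ hy]
          calc f y ^ 4 = f y ^ 2 * f y ^ 2 := by ring
            _ ≤ f y ^ 2 * _ := mul_le_mul_right (h y) _
            _ = _ := by ring
      _ = 2 * ∫⁻ x, ∫⁻ y, f y ^ 2 * {x | f x < f y}.indicator (fun x => g x * f x) x ∂m ∂m := by
          have hm : Measurable fun p : X × X =>
              f p.1 ^ 2 * {x | f x < f p.1}.indicator (fun x => g x * f x) p.2 := by
            refine ((hf.comp measurable_fst).pow_const 2).mul ?_
            exact Measurable.ite (measurableSet_lt (hf.comp measurable_snd)
              (hf.comp measurable_fst)) ((hg.mul hf).comp measurable_snd) measurable_const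
          rw [lintegral_const_mul _ hm.lintegral_prod_right, lintegral_lintegral_swap]
          exact hm.aemeasurable
      _ = 2 * ∫⁻ x, g x * (f x * N x) ∂m := by
          congr 1
          refine lintegral_congr fun x => ?_
          rw [hNi, ← mul_assoc, ← lintegral_const_mul _
            ((hf.pow_const 2).indicator (measurableSet_lt measurable_const hf))]
          refine lintegral_congr fun y => ?_
          by_cases hxy : f x < f y
          · simp [hxy, mul_comm]
          · simp [hxy]
  have hfN : Measurable fun x => f x * N x := hf.mul hNm
  have hgN : Measurable fun x => g x * (f x * N x) := hg.mul hfN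
  calc 6 * ∫⁻ x, f x ^ 4 ∂m ≤ 6 * (2 * ∫⁻ x, g x * (f x * N x) ∂m) := by gcongr
    _ = ∫⁻ x, 12 * (g x * (f x * N x)) ∂m := by
        rw [lintegral_const_mul _ hgN]
        ring
    -- Young's inequality, weighted so that the second term carries exactly the factor `3` of `h3`.
    _ ≤ ∫⁻ x, (12 * g x ^ 2 + 3 * (f x * N x) ^ 2) ∂m := by
        refine lintegral_mono fun x => ?_
        calc 12 * (g x * (f x * N x)) = 3 * (2 * ((2 * g x) * (f x * N x))) := by ring
          _ ≤ 3 * ((2 * g x) ^ 2 + (f x * N x) ^ 2) := by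
            gcongr
            exact ENNReal.two_mul_mul_le_sq_add_sq _ _
          _ = _ := by ring
    _ = 12 * ∫⁻ x, g x ^ 2 ∂m + 3 * ∫⁻ x, (f x * N x) ^ 2 ∂m := by
        rw [lintegral_add_left ((hg.pow_const 2).const_mul _), lintegral_const_mul _
          (hg.pow_const 2), lintegral_const_mul _ (hfN.pow_const 2)]
    _ ≤ _ := by gcongr

end MeasureTheory

/-! ### Truncation and lengths of images -/

/-- The derivative of the squared norm of `u`, truncated at the level `s`, vanishes outside
`{‖u‖ < s}` and is controlled by the derivative of `u` inside. -/
theorem enorm_deriv_min_norm_sq_le {u : ℝ → ℂ} {s x : ℝ} (hu : DifferentiableAt ℝ u x) :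
    ‖deriv (fun t => min ‖u t‖ s ^ 2) x‖ₑ ≤
      2 * {t | ‖u t‖ < s}.indicator (fun t => ‖deriv u t‖ₑ * ‖u t‖ₑ) x := by
  by_cases hx : ‖u x‖ < s
  · have hloc : (fun t => min ‖u t‖ s ^ 2) =ᶠ[nhds x] fun t => ‖u t‖ ^ 2 := by
      filter_upwards [hu.continuousAt.norm.eventually_lt continuousAt_const hx] with t ht
      rw [min_eq_left ht.le]
    rw [hloc.deriv_eq, hu.hasDerivAt.norm_sq.deriv, Set.indicator_of_mem (by exact hx),
      enorm_mul, ← enorm_mul (deriv u x)]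
    gcongr
    · simp [enorm_eq_nnnorm]
    · rw [enorm_le_iff_norm_le, norm_mul, mul_comm]
      exact norm_inner_le_norm _ _
  -- Where `s ≤ ‖u x‖` the truncation is at its maximum. Hence `deriv` is zero there even if the
  -- truncation has a kink, by the default value of `deriv`. For `s < 0` the truncation is constant.
  · have hmax : IsLocalMax (fun t => min ‖u t‖ s ^ 2) x := by
      rcases le_or_gt 0 s with hs | hs
      · refine Filter.Eventually.of_forall fun t => ?_
        change min ‖u t‖ s ^ 2 ≤ min ‖u x‖ s ^ 2
        rw [min_eq_right (not_lt.mp hx)]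
        exact pow_le_pow_left₀ (le_min (norm_nonneg _) hs) (min_le_right _ _) 2
      · refine Filter.Eventually.of_forall fun t => ?_
        change min ‖u t‖ s ^ 2 ≤ min ‖u x‖ s ^ 2
        rw [min_eq_right (not_lt.mp hx), min_eq_right (hs.le.trans (norm_nonneg _))]
    rw [hmax.deriv_eq_zero]
    simp

namespace AbsolutelyContinuousOnInterval

/-- The map `z ↦ min ‖z‖ s` is 1-Lipschitz, so its variation sums are dominated by those of `u`; the
square is a product of absolutely continuous functions. -/
theorem min_norm_sq {u : ℝ → ℂ} {a b : ℝ} (hu : AbsolutelyContinuousOnInterval u a b) (s : ℝ) :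
    AbsolutelyContinuousOnInterval (fun t => min ‖u t‖ s ^ 2) a b := by
  have h : AbsolutelyContinuousOnInterval (fun t => min ‖u t‖ s) a b := by
    refine squeeze_zero (fun t => Finset.sum_nonneg fun i _ => dist_nonneg)
      (fun t => Finset.sum_le_sum fun i _ => ?_) hu
    rw [Real.dist_eq, dist_eq_norm]
    exact (by simpa using abs_min_sub_min_le_max ‖u (t.2 i).1‖ s ‖u (t.2 i).2‖ s : _ ≤ _).trans
      (abs_norm_sub_norm_le _ _)
  convert h.mul h using 1
  ext t
  exact sq _

/-- The image of an interval under an absolutely continuous function has at most the length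
`∫ |f'|`. -/
theorem volume_image_le {f : ℝ → ℝ} {a b : ℝ} (hf : AbsolutelyContinuousOnInterval f a b)
    (hab : a ≤ b) :
    volume (f '' Set.Icc a b) ≤ ∫⁻ x in Set.Icc a b, ‖deriv f x‖ₑ := by
  have hc : ContinuousOn f (Set.Icc a b) := by
    simpa [Set.uIcc_of_le hab] using hf.continuousOn
  have hne : (Set.Icc a b).Nonempty := ⟨a, le_rfl, hab⟩
  obtain ⟨p, hp, hpm⟩ := isCompact_Icc.exists_isMinOn hne hc
  obtain ⟨q, hq, hqm⟩ := isCompact_Icc.exists_isMaxOn hne hc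
  have hsub : f '' Set.Icc a b ⊆ Set.Icc (f p) (f q) := by
    rintro _ ⟨x, hx, rfl⟩
    exact ⟨hpm hx, hqm hx⟩
  have hpq : Set.uIcc p q ⊆ Set.uIcc a b :=
    Set.uIcc_subset_uIcc (by rwa [Set.uIcc_of_le hab]) (by rwa [Set.uIcc_of_le hab])
  calc volume (f '' Set.Icc a b) ≤ volume (Set.Icc (f p) (f q)) := measure_mono hsub
    _ = ENNReal.ofReal (f q - f p) := Real.volume_Icc
    -- The minimizer `p` may lie on either side of the maximizer `q`; the oriented integral covers
    -- both cases.
    _ ≤ ‖∫ x in p..q, deriv f x‖ₑ := by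
        rw [(hf.mono hpq).integral_deriv_eq_sub]
        exact Real.ofReal_le_enorm _
    _ ≤ ∫⁻ x in Set.uIoc p q, ‖deriv f x‖ₑ := by
        rw [← ofReal_norm, intervalIntegral.norm_intervalIntegral_eq, ofReal_norm]
        exact enorm_integral_le_lintegral_enorm _
    _ ≤ ∫⁻ x in Set.Icc a b, ‖deriv f x‖ₑ := by
        refine lintegral_mono_set (Set.uIoc_subset_uIcc.trans ?_)
        rwa [Set.uIcc_of_le hab] at hpq

theorem volume_image_min_norm_sq_le {u : ℝ → ℂ} {a b : ℝ}
    (hu : AbsolutelyContinuousOnInterval u a b) (hab : a ≤ b) (s : ℝ) :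
    volume ((fun t => min ‖u t‖ s ^ 2) '' Set.Icc a b) ≤
      2 * ∫⁻ x in Set.Icc a b,
        {t | ‖u t‖ < s}.indicator (fun t => ‖deriv u t‖ₑ * ‖u t‖ₑ) x := by
  refine ((hu.min_norm_sq s).volume_image_le hab).trans ?_
  rw [← lintegral_const_mul' _ _ (by simp)]
  refine lintegral_mono_ae ?_
  rw [ae_restrict_iff' measurableSet_Icc]
  filter_upwards [hu.boundedVariationOn.ae_differentiableAt_of_mem_uIcc] with x hx hx'
  exact enorm_deriv_min_norm_sq_le (hx (by rwa [Set.uIcc_of_le hab]))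

end AbsolutelyContinuousOnInterval

/-! ### Paths to infinity and the pointwise bound -/

namespace MetricGraph

variable {V E : Type*} {G : MetricGraph V E}

theorem zero_mem_interval (e : E) : (0 : ℝ) ∈ G.interval e := ⟨le_rfl, by simp⟩

theorem toReal_length_mem_interval {e : E} (he : G.length e ≠ ⊤) :
    (G.length e).toReal ∈ G.interval e :=
  ⟨ENNReal.toReal_nonneg, by rw [ENNReal.ofReal_toReal he]⟩

theorem interval_eq_Ici {e : E} (he : G.length e = ⊤) : G.interval e = Set.Ici 0 := by
  ext x
  simp [interval, he]

theorem ordConnected_interval (e : E) : (G.interval e).OrdConnected :=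
  ⟨fun _ hx _ hy _ hz => ⟨hx.1.trans hz.1, (ENNReal.ofReal_le_ofReal hz.2).trans hy.2⟩⟩

theorem measurableSet_interval (e : E) : MeasurableSet (G.interval e) :=
  (ordConnected_interval e).measurableSet

namespace MemH1

variable {u : E → ℝ → ℂ}

theorem continuousOn (hu : G.MemH1 u) (e : E) : ContinuousOn (u e) (G.interval e) := by
  intro x hx
  by_cases h : ∃ y ∈ G.interval e, x < y
  · obtain ⟨y, hy, hxy⟩ := h
    have := (hu.absolutelyContinuous e 0 (zero_mem_interval e) y hy).continuousOn
    rw [Set.uIcc_of_le hy.1] at this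
    refine (this x ⟨hx.1, hxy.le⟩).mono_of_mem_nhdsWithin ?_
    filter_upwards [self_mem_nhdsWithin, mem_nhdsWithin_of_mem_nhds (Iio_mem_nhds hxy)] with t h1 h2
    exact ⟨h1.1, le_of_lt h2⟩
  · push Not at h
    have := (hu.absolutelyContinuous e 0 (zero_mem_interval e) x hx).continuousOn
    rw [Set.uIcc_of_le hx.1] at this
    exact (this x ⟨hx.1, le_rfl⟩).mono fun t ht => ⟨ht.1, h t ht⟩

theorem volume_image_min_norm_sq_le (hu : G.MemH1 u) (e : E) (s : ℝ) :
    volume ((fun t => min ‖u e t‖ s ^ 2) '' G.interval e) ≤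
      2 * ∫⁻ x in G.interval e,
        {t | ‖u e t‖ < s}.indicator (fun t => ‖grad u e t‖ₑ * ‖u e t‖ₑ) x := by
  have key : ∀ b ∈ G.interval e, volume ((fun t => min ‖u e t‖ s ^ 2) '' Set.Icc 0 b) ≤
      2 * ∫⁻ x in G.interval e,
        {t | ‖u e t‖ < s}.indicator (fun t => ‖grad u e t‖ₑ * ‖u e t‖ₑ) x := by
    intro b hb
    refine ((hu.absolutelyContinuous e 0 (zero_mem_interval e) b hb).volume_image_min_norm_sq_le
      hb.1 s).trans (mul_le_mul_right (lintegral_mono_set ?_) _)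
    exact (ordConnected_interval e).out (zero_mem_interval e) hb
  -- The bound `key` is uniform in `b`, so a halfline is exhausted by the intervals `[0, n]`.
  by_cases he : G.length e = ⊤
  · have hU : G.interval e = ⋃ n : ℕ, Set.Icc (0 : ℝ) n := by
      ext x
      simp only [interval_eq_Ici he, Set.mem_Ici, Set.mem_iUnion, Set.mem_Icc]
      exact ⟨fun h => (exists_nat_ge x).imp fun n hn => ⟨h, hn⟩, fun ⟨n, h⟩ => h.1⟩
    conv_lhs => rw [hU, Set.image_iUnion]
    rw [Monotone.measure_iUnion]
    · refine iSup_le fun n => key n ?_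
      simp [interval_eq_Ici he]
    · intro m n hmn
      exact Set.image_mono (Set.Icc_subset_Icc_right (by exact_mod_cast hmn))
  · refine (measure_mono (Set.image_mono fun x hx => ?_)).trans
      (key _ (toReal_length_mem_interval he))
    exact ⟨hx.1, (ENNReal.ofReal_le_iff_le_toReal he).mp hx.2⟩

theorem continuousOn_norm_sq (hu : G.MemH1 u) (e : E) :
    ContinuousOn (fun t => ‖u e t‖ ^ 2) (G.interval e) :=
  (hu.continuousOn e).norm.pow 2

theorem uIcc_subset_image (hu : G.MemH1 u) {e : E} {x y : ℝ} (hx : x ∈ G.interval e)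
    (hy : y ∈ G.interval e) :
    Set.uIcc (‖u e x‖ ^ 2) (‖u e y‖ ^ 2) ⊆ (fun t => ‖u e t‖ ^ 2) '' G.interval e := by
  have := ordConnected_interval (G := G) e
  exact (intermediate_value_uIcc ((hu.continuousOn_norm_sq e).mono (this.uIcc_subset hx hy))).trans
    (Set.image_mono (this.uIcc_subset hx hy))

/-- On a halfline, a function of `H¹` comes arbitrarily close to zero. -/
theorem exists_norm_sq_lt (hu : G.MemH1 u) {e : E} (he : G.length e = ⊤) {ε : ℝ} (hε : 0 < ε) :
    ∃ x ∈ G.interval e, ‖u e x‖ ^ 2 < ε := by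
  by_contra! h
  have hint : IntegrableOn (fun t => ‖u e t‖ ^ 2) (G.interval e) :=
    (hu.memLp e).integrable_norm_pow (by simp)
  have hc : IntegrableOn (fun _ => ε) (G.interval e) := by
    refine Integrable.mono' hint aestronglyMeasurable_const ?_
    rw [ae_restrict_iff' (measurableSet_interval e)]
    refine Filter.Eventually.of_forall fun x hx => ?_
    rw [Real.norm_of_nonneg hε.le]
    exact h x hx
  rw [integrableOn_const_iff, interval_eq_Ici he] at hc
  simp [hε.ne'] at hc

/-- Intermediate values between `x` and a point where `|u|²` is below the target. The value `0` has
to be left out, since it may only be approached. -/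
theorem uIoc_zero_subset_image (hu : G.MemH1 u) {e : E} (he : G.length e = ⊤) {x : ℝ}
    (hx : x ∈ G.interval e) :
    Set.uIoc (‖u e x‖ ^ 2) 0 ⊆ (fun t => ‖u e t‖ ^ 2) '' G.interval e := by
  intro t ht
  rw [Set.uIoc_comm, Set.uIoc_of_le (by positivity)] at ht
  obtain ⟨y, hy, hyt⟩ := hu.exists_norm_sq_lt he ht.1
  exact hu.uIcc_subset_image hy hx (Set.Icc_subset_uIcc ⟨hyt.le, ht.2⟩)

/-- If `x` is a point of the graph, then finitely many edges suffice to attain all values in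
`(0, |u(x)|²]`: those of a path that leads from `x` to infinity. -/
theorem exists_finset_Ioc_subset (hu : G.MemH1 u) (hG : G.IsNoncompact) {e : E} {x : ℝ}
    (hx : x ∈ G.interval e) :
    ∃ T : Finset E, Set.Ioc 0 (‖u e x‖ ^ 2) ⊆
      ⋃ i ∈ T, (fun t => ‖u i t‖ ^ 2) '' G.interval i := by
  classical
  obtain ⟨w, hw0, hw1⟩ := hu.continuous_at_vertices
  -- At infinity `w` is unconstrained and is replaced by zero. With half-open intervals between
  -- values of `W`, a trivial path needs no edge and concatenated paths need the union of their
  -- edges.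
  let W : V → ℝ := fun v => if v ∈ G.atInfinity then 0 else ‖w v‖ ^ 2
  have hsrc : ∀ i, W (G.src i) = ‖u i 0‖ ^ 2 := fun i => by simp [W, G.src_notMem, hw0]
  have hinf : ∀ i, G.length i = ⊤ → W (G.tgt i) = 0 := fun i hi => by
    simp [W, (G.length_eq_top_iff i).mp hi]
  have hedge : ∀ i, Set.uIoc (W (G.src i)) (W (G.tgt i)) ⊆
      (fun t => ‖u i t‖ ^ 2) '' G.interval i := by
    intro i
    by_cases hi : G.length i = ⊤
    · rw [hsrc, hinf i hi]
      exact hu.uIoc_zero_subset_image hi (zero_mem_interval i)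
    · have : W (G.tgt i) = ‖u i (G.length i).toReal‖ ^ 2 := by
        simp [W, mt (G.length_eq_top_iff i).mpr hi, hw1 i hi]
      rw [hsrc, this]
      exact Set.uIoc_subset_uIcc.trans
        (hu.uIcc_subset_image (zero_mem_interval i) (toReal_length_mem_interval hi))
  have hpath : ∀ v v', ∃ T : Finset E, Set.uIoc (W v) (W v') ⊆
      ⋃ i ∈ T, (fun t => ‖u i t‖ ^ 2) '' G.interval i := by
    intro v v'
    induction G.connected v v' with
    | rel a b h =>
      obtain ⟨i, rfl, rfl⟩ := h
      exact ⟨{i}, by simpa using hedge i⟩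
    | refl a => exact ⟨∅, by simp⟩
    | symm a b _ ih => simpa only [Set.uIoc_comm] using ih
    | trans a b c _ _ ih₁ ih₂ =>
      obtain ⟨T₁, h₁⟩ := ih₁
      obtain ⟨T₂, h₂⟩ := ih₂
      refine ⟨T₁ ∪ T₂, (Set.uIoc_subset_uIoc_union_uIoc _ (W b) _).trans ?_⟩
      rw [Finset.set_biUnion_union]
      exact Set.union_subset_union h₁ h₂
  obtain ⟨i, hi⟩ := hG
  obtain ⟨T, hT⟩ := hpath (G.src e) (G.tgt i)
  rw [hinf i hi, hsrc] at hT
  refine ⟨insert e T, ?_⟩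
  rw [Finset.set_biUnion_insert, ← Set.uIoc_of_le (by positivity), Set.uIoc_comm]
  exact (Set.uIoc_subset_uIoc_union_uIoc _ (‖u e 0‖ ^ 2) _).trans (Set.union_subset_union
    (Set.uIoc_subset_uIcc.trans (hu.uIcc_subset_image hx (zero_mem_interval e))) hT)

/-- A function of `H¹` on a non-compact graph satisfies
`|u(x)|² ≤ 2 ∫ |u'| |u|` with the integral over `{|u| < |u(x)|}` only. -/
theorem enorm_sq_le_tsum (hu : G.MemH1 u) (hG : G.IsNoncompact) {e : E} {x : ℝ}
    (hx : x ∈ G.interval e) :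
    ‖u e x‖ₑ ^ 2 ≤ 2 * ∑' i, ∫⁻ t in G.interval i,
      {t | ‖u i t‖ < ‖u e x‖}.indicator (fun t => ‖grad u i t‖ₑ * ‖u i t‖ₑ) t := by
  obtain ⟨T, hT⟩ := hu.exists_finset_Ioc_subset hG hx
  set s := ‖u e x‖
  -- Strictly below `s ^ 2` the truncation is inactive, and omitting the endpoint costs no length.
  have hcov : Set.Ioo 0 (s ^ 2) ⊆ ⋃ i ∈ T, (fun t => min ‖u i t‖ s ^ 2) '' G.interval i := by
    intro r hr
    obtain ⟨i, hi, t, ht, rfl⟩ := by simpa using hT (Set.Ioo_subset_Ioc_self hr)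
    refine Set.mem_biUnion hi ⟨t, ht, ?_⟩
    have : ‖u i t‖ < s := lt_of_pow_lt_pow_left₀ 2 (norm_nonneg _) hr.2
    simp [min_eq_left this.le]
  calc ‖u e x‖ₑ ^ 2 = volume (Set.Ioo 0 (s ^ 2)) := by
        rw [Real.volume_Ioo, sub_zero, ENNReal.ofReal_pow (norm_nonneg _), ofReal_norm]
    _ ≤ ∑ i ∈ T, volume ((fun t => min ‖u i t‖ s ^ 2) '' G.interval i) :=
        (measure_mono hcov).trans (measure_biUnion_finset_le _ _)
    _ ≤ ∑ i ∈ T, 2 * ∫⁻ t in G.interval i,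
          {t | ‖u i t‖ < s}.indicator (fun t => ‖grad u i t‖ₑ * ‖u i t‖ₑ) t :=
        Finset.sum_le_sum fun i _ => hu.volume_image_min_norm_sq_le i s
    _ ≤ _ := by
        rw [← Finset.mul_sum]
        gcongr
        exact ENNReal.sum_le_tsum T

end MemH1

end MetricGraph

/-! ### The lower bound for the energy -/

namespace MetricGraph

variable {V E : Type*} {G : MetricGraph V E}

theorem lintegral_interval_enorm_pow {q : ℕ} {f : ℝ → ℂ} {e : E}
    (hf : AEStronglyMeasurable f (volume.restrict (G.interval e))) :
    (∫ x in G.interval e, ‖f x‖ ^ q) = (∫⁻ x in G.interval e, ‖f x‖ₑ ^ q).toReal := by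
  have hm : AEStronglyMeasurable (fun x => ‖f x‖ ^ q) (volume.restrict (G.interval e)) :=
    hf.norm.pow q
  rw [integral_eq_lintegral_of_nonneg_ae (Filter.Eventually.of_forall fun x => by positivity) hm]
  simp only [ENNReal.ofReal_pow (norm_nonneg _), ofReal_norm]

theorem normPow_eq_toReal {q : ℕ} {v : E → ℝ → ℂ}
    (hv : ∀ e, AEStronglyMeasurable (v e) (volume.restrict (G.interval e)))
    (hfin : ∀ e, ∫⁻ x in G.interval e, ‖v e x‖ₑ ^ q ≠ ⊤) :
    G.normPow q v = (∑' e, ∫⁻ x in G.interval e, ‖v e x‖ₑ ^ q).toReal := by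
  rw [ENNReal.tsum_toReal_eq hfin]
  exact tsum_congr fun e => lintegral_interval_enorm_pow (hv e)

theorem lintegral_sq_ne_top_of_memLp {f : ℝ → ℂ} {e : E}
    (hf : MemLp f 2 (volume.restrict (G.interval e))) :
    ∫⁻ x in G.interval e, ‖f x‖ₑ ^ 2 ≠ ⊤ := by
  have := (hf.integrable_norm_pow (p := 2) (by simp)).2.ne
  simpa [enorm_pow] using this

theorem ofReal_normPow_two {v : E → ℝ → ℂ}
    (hv : ∀ e, MemLp (v e) 2 (volume.restrict (G.interval e)))
    (hs : Summable fun e => ∫ x in G.interval e, ‖v e x‖ ^ 2) :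
    ENNReal.ofReal (G.normPow 2 v) = ∑' e, ∫⁻ x in G.interval e, ‖v e x‖ₑ ^ 2 := by
  rw [normPow, ENNReal.ofReal_tsum_of_nonneg (fun e => integral_nonneg fun x => by positivity) hs]
  refine tsum_congr fun e => ?_
  rw [lintegral_interval_enorm_pow (hv e).1,
    ENNReal.ofReal_toReal (lintegral_sq_ne_top_of_memLp (hv e))]

namespace MemH1

variable {u : E → ℝ → ℂ}

/-- Summability of the mass leaves only countably many edges on which `u` is not almost everywhere
zero. Their disjoint union is modelled by an s-finite measure on `S × ℝ`, to which the abstract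
inequality applies. The gradient terms of the other edges only enlarge the right-hand side. -/
theorem six_mul_tsum_pow_four_le (hu : G.MemH1 u) (hG : G.IsNoncompact) :
    6 * ∑' e, ∫⁻ x in G.interval e, ‖u e x‖ₑ ^ 4 ≤
      12 * (∑' e, ∫⁻ x in G.interval e, ‖grad u e x‖ₑ ^ 2) +
        (∑' e, ∫⁻ x in G.interval e, ‖u e x‖ₑ ^ 2) ^ 3 := by
  classical
  let S : Set E := Function.support fun e => ∫ x in G.interval e, ‖u e x‖ ^ 2
  have hS : Countable S := hu.summable.countable_support
  have hzero : ∀ e ∉ S, ∀ᵐ x ∂volume.restrict (G.interval e), u e x = 0 := by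
    intro e he
    have h0 : ∫ x in G.interval e, ‖u e x‖ ^ 2 = 0 := Function.notMem_support.mp he
    rw [integral_eq_zero_iff_of_nonneg (fun x => by positivity)
      ((hu.memLp e).integrable_norm_pow (by simp))] at h0
    filter_upwards [h0] with x hx
    simpa using hx
  have htsum : ∀ F : E → ℝ → ℝ≥0∞, (∀ e x, u e x = 0 → F e x = 0) →
      ∑' e, ∫⁻ x in G.interval e, F e x = ∑' e : S, ∫⁻ x in G.interval e, F e x := by
    intro F hF
    refine (tsum_subtype_eq_of_support_subset fun e he => ?_).symm
    by_contra h
    refine he (lintegral_eq_zero_of_ae_eq_zero ?_)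
    filter_upwards [hzero e h] with x hx using hF e x hx
  let _ : MeasurableSpace S := ⊤
  let m : Measure (S × ℝ) := Measure.sum fun e : S =>
    (volume.restrict (G.interval e)).map (Prod.mk e)
  -- Outside the interval `u` is arbitrary, perhaps not measurable, so it is cut off there; `deriv`
  -- is measurable in any case.
  let f : S × ℝ → ℝ≥0∞ := fun p => (G.interval p.1).indicator (fun x => ‖u p.1 x‖ₑ) p.2
  let g : S × ℝ → ℝ≥0∞ := fun p => ‖grad u p.1 p.2‖ₑ
  have hf : Measurable f := measurable_from_prod_countable_right fun e => by
    have : Measurable ((G.interval e).piecewise (fun x => ‖u e x‖ₑ) 0) :=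
      (hu.continuousOn e).enorm.measurable_piecewise continuousOn_const
        (measurableSet_interval (e : E))
    simpa only [Set.piecewise_eq_indicator] using this
  have hg : Measurable g := measurable_from_prod_countable_right fun e =>
    (measurable_deriv (u e)).enorm
  have hm : ∀ F : S × ℝ → ℝ≥0∞, Measurable F →
      ∫⁻ p, F p ∂m = ∑' e : S, ∫⁻ x in G.interval e, F (e, x) := by
    intro F hF
    rw [lintegral_sum_measure]
    exact tsum_congr fun e => lintegral_map hF measurable_prodMk_left
  have hfe : ∀ e : S, ∀ x ∈ G.interval e, f (e, x) = ‖u e x‖ₑ := fun e x hx =>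
    Set.indicator_of_mem hx _
  have hfpow : ∀ n, ∫⁻ p, f p ^ n ∂m = ∑' e : S, ∫⁻ x in G.interval e, ‖u e x‖ₑ ^ n := by
    intro n
    rw [hm _ (hf.pow_const n)]
    refine tsum_congr fun e => setLIntegral_congr_fun (measurableSet_interval _) fun x hx => ?_
    simp only [hfe e x hx]
  have key := six_mul_lintegral_pow_four_le m hf hg ?_
  · rw [hfpow, hfpow, hm _ (hg.pow_const 2)] at key
    rw [htsum (fun e x => ‖u e x‖ₑ ^ 4) (by simp +contextual),
      htsum (fun e x => ‖u e x‖ₑ ^ 2) (by simp +contextual)]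
    refine key.trans ?_
    gcongr
    exact ENNReal.tsum_comp_le_tsum_of_injective Subtype.val_injective
      fun e => ∫⁻ x in G.interval e, ‖grad u e x‖ₑ ^ 2
  · rintro ⟨e, y⟩
    by_cases hy : y ∈ G.interval e
    · rw [hfe e y hy, hm]
      · refine (hu.enorm_sq_le_tsum hG hy).trans (le_of_eq ?_)
        rw [htsum]
        · congr 1
          refine tsum_congr fun i =>
            setLIntegral_congr_fun (measurableSet_interval _) fun x hx => ?_
          have hlt : ‖u i x‖ₑ < ‖u e y‖ₑ ↔ ‖u i x‖ < ‖u e y‖ := by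
            rw [← ofReal_norm, ← ofReal_norm, ENNReal.ofReal_lt_ofReal_iff_of_nonneg (norm_nonneg _)]
          simp only [Set.indicator_apply, Set.mem_ofPred_eq, hfe i x hx, hlt, g]
        · intro i x hx
          simp [Set.indicator_apply, hx]
      · exact (hg.mul hf).indicator (measurableSet_lt hf measurable_const)
    · simp [f, hy]

/-- The sharp lower bound for the energy on a non-compact graph, attained in the limit by half a
soliton on a halfline. -/
theorem neg_le_energy (hu : G.MemH1 u) (hG : G.IsNoncompact) :
    -(G.normPow 2 u ^ 3 / 24) ≤ G.energy u := by
  have key := hu.six_mul_tsum_pow_four_le hG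
  have h2 : 0 ≤ G.normPow 2 u := tsum_nonneg fun e => integral_nonneg fun x => by positivity
  have h2' : 0 ≤ G.normPow 2 (grad u) :=
    tsum_nonneg fun e => integral_nonneg fun x => by positivity
  rw [← ofReal_normPow_two hu.memLp hu.summable,
    ← ofReal_normPow_two hu.memLp_grad hu.summable_grad] at key
  set B := ∑' e, ∫⁻ x in G.interval e, ‖u e x‖ₑ ^ 4 with hB
  have hR : 12 * ENNReal.ofReal (G.normPow 2 (grad u)) + ENNReal.ofReal (G.normPow 2 u) ^ 3 =
      ENNReal.ofReal (12 * G.normPow 2 (grad u) + G.normPow 2 u ^ 3) := by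
    rw [ENNReal.ofReal_add (by positivity) (by positivity), ENNReal.ofReal_mul (by norm_num),
      ENNReal.ofReal_pow h2]
    norm_num
  rw [hR] at key
  -- The inequality itself yields finiteness of the `L⁴` norm, so the real integrals and sum in
  -- `normPow` are not default values.
  have hBfin : B ≠ ⊤ := by
    intro h
    rw [h] at key
    simp at key
  have h4 : G.normPow 4 u = B.toReal :=
    normPow_eq_toReal (fun e => (hu.memLp e).1) (ENNReal.ne_top_of_tsum_ne_top hBfin)
  have := ENNReal.toReal_le_of_le_ofReal (by positivity) key
  rw [ENNReal.toReal_mul, ← h4] at this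
  norm_num at this
  rw [energy]
  linarith

end MemH1

end MetricGraph

/-! ### Competitors supported on one halfline -/

namespace MetricGraph

variable {V E : Type*} {G : MetricGraph V E}

open Classical in
/-- The function on the graph that equals `p` on the edge `e` and vanishes on all other edges. -/
noncomputable def extendEdge (e : E) (p : ℝ → ℝ) : E → ℝ → ℂ :=
  fun i x => if i = e then (p x : ℂ) else 0

theorem extendEdge_self (e : E) (p : ℝ → ℝ) : extendEdge e p e = fun x => (p x : ℂ) := by
  ext x
  simp [extendEdge]

theorem extendEdge_of_ne {e i : E} (h : i ≠ e) (p : ℝ → ℝ) : extendEdge e p i = 0 := by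
  ext x
  simp [extendEdge, h]

theorem grad_extendEdge_of_ne {e i : E} (h : i ≠ e) (p : ℝ → ℝ) :
    grad (extendEdge e p) i = 0 := by
  rw [grad, extendEdge_of_ne h]
  exact deriv_const' 0

theorem normPow_eq_of_single {q : ℕ} (hq : q ≠ 0) {e : E} (he : G.length e = ⊤)
    {v : E → ℝ → ℂ} (hv : ∀ i ≠ e, v i = 0) :
    G.normPow q v = ∫ x in Set.Ici 0, ‖v e x‖ ^ q := by
  rw [normPow, tsum_eq_single e fun i hi => by simp [hv i hi, hq], interval_eq_Ici he]

variable {e : E} {p p' : ℝ → ℝ}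

theorem normPow_extendEdge (he : G.length e = ⊤) {q : ℕ} (hq : q ≠ 0) :
    G.normPow q (extendEdge e p) = ∫ x in Set.Ici 0, ‖p x‖ ^ q := by
  rw [normPow_eq_of_single hq he fun i hi => extendEdge_of_ne hi p, extendEdge_self]
  simp

theorem grad_extendEdge_ae_eq
    (hp' : ∀ᵐ x ∂volume.restrict (Set.Ici (0 : ℝ)), HasDerivAt p (p' x) x) :
    grad (extendEdge e p) e =ᵐ[volume.restrict (Set.Ici (0 : ℝ))] fun x => (p' x : ℂ) := by
  filter_upwards [hp'] with x hx
  rw [grad, extendEdge_self]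
  exact hx.ofReal_comp.deriv

theorem normPow_grad_extendEdge (he : G.length e = ⊤)
    (hp' : ∀ᵐ x ∂volume.restrict (Set.Ici (0 : ℝ)), HasDerivAt p (p' x) x) :
    G.normPow 2 (grad (extendEdge e p)) = ∫ x in Set.Ici 0, ‖p' x‖ ^ 2 := by
  rw [normPow_eq_of_single two_ne_zero he fun i hi => grad_extendEdge_of_ne hi p]
  refine integral_congr_ae ?_
  filter_upwards [grad_extendEdge_ae_eq (e := e) hp'] with x hx
  rw [hx, Complex.norm_real]

/-- Vanishing at `0` lets the extension by zero match at the finite endpoint, whatever else is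
attached there. The derivative is prescribed only almost everywhere, so kinks are allowed. -/
theorem memH1_extendEdge (he : G.length e = ⊤) {K : NNReal} (hp : LipschitzWith K p)
    (hp0 : p 0 = 0)
    (hp' : ∀ᵐ x ∂volume.restrict (Set.Ici (0 : ℝ)), HasDerivAt p (p' x) x)
    (hint : IntegrableOn (fun x => ‖p x‖ ^ 2) (Set.Ici 0))
    (hint' : IntegrableOn (fun x => ‖p' x‖ ^ 2) (Set.Ici 0)) :
    G.MemH1 (extendEdge e p) where
  absolutelyContinuous i a _ b _ := by
    by_cases hi : i = e
    · subst hi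
      rw [extendEdge_self]
      exact (Complex.isometry_ofReal.lipschitz.comp hp).lipschitzOnWith.absolutelyContinuousOnInterval
    · rw [extendEdge_of_ne hi]
      exact ((LipschitzWith.const (0 : ℂ)).lipschitzOnWith).absolutelyContinuousOnInterval
  memLp i := by
    by_cases hi : i = e
    · subst hi
      rw [extendEdge_self, interval_eq_Ici he, memLp_two_iff_integrable_sq_norm]
      · simpa [IntegrableOn] using hint
      · exact (Complex.continuous_ofReal.comp hp.continuous).aestronglyMeasurable
    · simp [extendEdge_of_ne hi]
  memLp_grad i := by
    by_cases hi : i = e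
    · subst hi
      rw [interval_eq_Ici he, memLp_two_iff_integrable_sq_norm]
      · refine Integrable.congr hint' ?_
        filter_upwards [grad_extendEdge_ae_eq (e := i) hp'] with x hx
        rw [hx, Complex.norm_real]
      · exact (measurable_deriv _).aestronglyMeasurable
    · simp [grad_extendEdge_of_ne hi]
  summable := (hasSum_single e fun i hi => by simp [extendEdge_of_ne hi]).summable
  summable_grad := (hasSum_single e fun i hi => by simp [grad_extendEdge_of_ne hi]).summable
  continuous_at_vertices := by
    refine ⟨0, fun i => ?_, fun i hi => ?_⟩
    · by_cases h : i = e
      · subst h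
        simp [extendEdge_self, hp0]
      · simp [extendEdge_of_ne h]
    · have : i ≠ e := fun h => hi (h ▸ he)
      simp [extendEdge_of_ne this]

/-- A profile on the halfline with `∫ p² = M`, `∫ p'² = A` and `∫ p⁴ = B` gives, after
normalization of the mass, an upper bound for the ground-state energy. -/
theorem groundEnergy_le_of_profile (he : G.length e = ⊤) {K : NNReal} (hp : LipschitzWith K p)
    (hp0 : p 0 = 0)
    (hp' : ∀ᵐ x ∂volume.restrict (Set.Ici (0 : ℝ)), HasDerivAt p (p' x) x)
    (hint : IntegrableOn (fun x => ‖p x‖ ^ 2) (Set.Ici 0))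
    (hint' : IntegrableOn (fun x => ‖p' x‖ ^ 2) (Set.Ici 0)) {M A B μ : ℝ} (hμ : 0 < μ)
    (hM0 : 0 < M) (hM : ∫ x in Set.Ici 0, ‖p x‖ ^ 2 = M) (hA : ∫ x in Set.Ici 0, ‖p' x‖ ^ 2 = A)
    (hB : ∫ x in Set.Ici 0, ‖p x‖ ^ 4 = B) :
    G.groundEnergy μ ≤ ((1 / 2 * (μ / M * A) - 1 / 4 * ((μ / M) ^ 2 * B) : ℝ) : EReal) := by
  -- Scaling the amplitude by `c` turns mass `M` into `μ`; the quadratic term scales by `c ^ 2`, the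
  -- quartic one by `c ^ 4`.
  set c := √(μ / M) with hc
  have hc2 : c ^ 2 = μ / M := Real.sq_sqrt (by positivity)
  have hc4 : c ^ 4 = (μ / M) ^ 2 := by rw [← hc2]; ring
  have hc0 : 0 ≤ c := Real.sqrt_nonneg _
  have hcp' : ∀ᵐ x ∂volume.restrict (Set.Ici (0 : ℝ)),
      HasDerivAt (fun x => c * p x) (c * p' x) x := by
    filter_upwards [hp'] with x hx using hx.const_mul c
  have hcp : LipschitzWith (‖c‖₊ * K) fun x => c * p x := (lipschitzWith_smul c).comp hp
  have hmem : G.MemH1 (extendEdge e fun x => c * p x) := by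
    refine memH1_extendEdge he hcp (by simp [hp0]) hcp' ?_ ?_
    · simp only [norm_mul, mul_pow]
      exact Integrable.const_mul hint _
    · simp only [norm_mul, mul_pow]
      exact Integrable.const_mul hint' _
  have hmass : G.normPow 2 (extendEdge e fun x => c * p x) = μ := by
    rw [normPow_extendEdge he two_ne_zero]
    simp only [norm_mul, mul_pow, integral_const_mul]
    rw [hM, Real.norm_of_nonneg hc0, hc2]
    field_simp
  have hen : G.energy (extendEdge e fun x => c * p x) =
      1 / 2 * (μ / M * A) - 1 / 4 * ((μ / M) ^ 2 * B) := by
    rw [energy, normPow_extendEdge he four_ne_zero, normPow_grad_extendEdge he hcp']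
    simp only [norm_mul, mul_pow, integral_const_mul]
    rw [hA, hB, Real.norm_of_nonneg hc0, hc2, hc4]
  rw [← hen]
  exact iInf₂_le _ ⟨hmem, hmass⟩

end MetricGraph

/-! ### The truncated soliton and its integrals -/

section SolitonProfile

open Filter Topology

theorem Real.tendsto_tanh_atTop : Tendsto Real.tanh atTop (𝓝 1) := by
  have h0 : Tendsto (fun y : ℝ => Real.exp (-(2 * y))) atTop (𝓝 0) :=
    Real.tendsto_exp_neg_atTop_nhds_zero.comp (tendsto_id.const_mul_atTop two_pos)
  have := (h0.const_sub 1).div (h0.const_add 1) (by norm_num)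
  norm_num at this
  refine this.congr fun y => ?_
  have h1 : Real.exp (-(2 * y)) = Real.exp (-y) * Real.exp (-y) := by
    rw [← Real.exp_add]; ring_nf
  have h2 : Real.exp y * Real.exp (-y) = 1 := by rw [← Real.exp_add]; simp
  have h3 := Real.exp_pos y
  have h4 := Real.exp_pos (-y)
  change (1 - Real.exp (-(2 * y))) / (1 + Real.exp (-(2 * y))) = _
  rw [Real.tanh_eq, h1, div_eq_div_iff (by positivity) (by positivity)]
  linear_combination (-2 * Real.exp (-y)) * h2

theorem Real.tendsto_tanh_atBot : Tendsto Real.tanh atBot (𝓝 (-1)) := by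
  refine (Real.tendsto_tanh_atTop.comp tendsto_neg_atBot_atTop).neg.congr fun y => ?_
  simp [Real.tanh_neg]

theorem Real.one_sub_tanh_sq (y : ℝ) : 1 - Real.tanh y ^ 2 = 1 / Real.cosh y ^ 2 := by
  have := Real.cosh_pos y
  rw [Real.tanh_eq_sinh_div_cosh]
  field_simp
  linarith [Real.cosh_sq y]

theorem Real.hasDerivAt_tanh_of_one_sub_sq (y : ℝ) :
    HasDerivAt Real.tanh (1 - Real.tanh y ^ 2) y := by
  have h := (Real.hasDerivAt_sinh y).div (Real.hasDerivAt_cosh y) (Real.cosh_pos y).ne'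
  have hf : Real.tanh = Real.sinh / Real.cosh := funext Real.tanh_eq_sinh_div_cosh
  rw [← hf] at h
  refine h.congr_deriv ?_
  rw [Real.one_sub_tanh_sq, ← Real.cosh_sq_sub_sinh_sq y]
  ring

theorem Real.hasDerivAt_inv_cosh (y : ℝ) :
    HasDerivAt (fun y => (Real.cosh y)⁻¹) (-(Real.tanh y / Real.cosh y)) y := by
  refine ((Real.hasDerivAt_cosh y).inv (Real.cosh_pos y).ne').congr_deriv ?_
  have := Real.cosh_pos y
  rw [Real.tanh_eq_sinh_div_cosh]
  field_simp

theorem Real.lipschitzWith_inv_cosh : LipschitzWith 1 fun y => (Real.cosh y)⁻¹ := by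
  refine lipschitzWith_of_nnnorm_deriv_le (fun y => (Real.hasDerivAt_inv_cosh y).differentiableAt)
    fun y => ?_
  rw [(Real.hasDerivAt_inv_cosh y).deriv, ← NNReal.coe_le_coe, coe_nnnorm, norm_neg, norm_div,
    Real.norm_eq_abs, Real.norm_eq_abs, abs_of_pos (Real.cosh_pos y)]
  exact div_le_one_of_le₀ ((Real.abs_tanh_lt_one y).le.trans (Real.one_le_cosh y))
    (Real.cosh_pos y).le

/-- A soliton on `[1, ∞)`, continued to `[0, 1]` by a linear function that vanishes at `0`. -/
noncomputable def solitonProfile (b t x : ℝ) : ℝ :=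
  √2 * b * ((Real.cosh (b * (max x 1 - 1) + t))⁻¹ + (Real.cosh t)⁻¹ * (min x 1 - 1))

/-- The derivative of `solitonProfile`. -/
noncomputable def solitonProfileDeriv (b t x : ℝ) : ℝ :=
  if x < 1 then √2 * b * (Real.cosh t)⁻¹ else
    √2 * b * (-(Real.tanh (b * (x - 1) + t) / Real.cosh (b * (x - 1) + t)) * b)

variable (b t : ℝ)

theorem solitonProfile_of_le {x : ℝ} (hx : x ≤ 1) :
    solitonProfile b t x = √2 * b * (Real.cosh t)⁻¹ * x := by
  rw [solitonProfile, max_eq_right hx, min_eq_left hx]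
  ring_nf

theorem solitonProfile_of_ge {x : ℝ} (hx : 1 ≤ x) :
    solitonProfile b t x = √2 * b * (Real.cosh (b * (x - 1) + t))⁻¹ := by
  rw [solitonProfile, max_eq_left hx, min_eq_right hx]
  ring_nf

theorem hasDerivAt_solitonProfile {x : ℝ} (hx : x ≠ 1) :
    HasDerivAt (solitonProfile b t) (solitonProfileDeriv b t x) x := by
  rcases hx.lt_or_gt with h | h
  · rw [solitonProfileDeriv, if_pos h]
    have := (hasDerivAt_id x).const_mul (√2 * b * (Real.cosh t)⁻¹)
    rw [mul_one] at this
    refine this.congr_of_eventuallyEq ?_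
    filter_upwards [Iio_mem_nhds h] with y hy using solitonProfile_of_le b t (le_of_lt hy)
  · rw [solitonProfileDeriv, if_neg h.not_gt]
    have h1 : HasDerivAt (fun x => b * (x - 1) + t) b x := by
      simpa using (((hasDerivAt_id x).sub_const 1).const_mul b).add_const t
    have := ((Real.hasDerivAt_inv_cosh _).comp x h1).const_mul (√2 * b)
    refine this.congr_of_eventuallyEq ?_
    filter_upwards [Ioi_mem_nhds h] with y hy using solitonProfile_of_ge b t (le_of_lt hy)

/-- The formula with `max` and `min` is built from Lipschitz maps by sums and compositions, so the
two pieces need no gluing argument. -/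
theorem exists_lipschitzWith_solitonProfile : ∃ K, LipschitzWith K (solitonProfile b t) := by
  have h1 : LipschitzWith 1 fun x : ℝ => max x 1 - 1 := by
    simpa using (LipschitzWith.id.max_const (1 : ℝ)).sub (LipschitzWith.const (1 : ℝ))
  have h2 : LipschitzWith 1 fun x : ℝ => min x 1 - 1 := by
    simpa using (LipschitzWith.id.min_const (1 : ℝ)).sub (LipschitzWith.const (1 : ℝ))
  have h3 := ((lipschitzWith_smul b).comp h1).add (LipschitzWith.const t)
  exact ⟨_, (lipschitzWith_smul (√2 * b)).comp ((Real.lipschitzWith_inv_cosh.comp h3).add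
    ((lipschitzWith_smul (Real.cosh t)⁻¹).comp h2))⟩

variable {b}

theorem hasDerivAt_tanh_affine (x : ℝ) :
    HasDerivAt (fun x => Real.tanh (b * (x - 1) + t))
      (b * (1 - Real.tanh (b * (x - 1) + t) ^ 2)) x := by
  have h1 : HasDerivAt (fun x => b * (x - 1) + t) b x := by
    simpa using (((hasDerivAt_id x).sub_const 1).const_mul b).add_const t
  rw [mul_comm]
  exact (Real.hasDerivAt_tanh_of_one_sub_sq _).comp x h1

theorem tendsto_tanh_affine (hb : 0 < b) :
    Tendsto (fun x => Real.tanh (b * (x - 1) + t)) atTop (𝓝 1) := by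
  refine Real.tendsto_tanh_atTop.comp (tendsto_atTop_add_const_right _ _ ?_)
  exact (tendsto_atTop_add_const_right _ (-1) tendsto_id).const_mul_atTop hb

/-- The integral over the halfline of a function that is a monomial on `[0, 1]` and the derivative
of a polynomial in `tanh` on `[1, ∞)`. -/
theorem integral_Ici_of_monomial_of_tanh (hb : 0 < b) {f P P' : ℝ → ℝ} {k : ℝ} {n : ℕ}
    (hf0 : ∀ x, 0 ≤ f x) (hle : ∀ x < 1, f x = k * x ^ n)
    (hge : ∀ x, 1 < x → f x = P' (Real.tanh (b * (x - 1) + t)) *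
      (b * (1 - Real.tanh (b * (x - 1) + t) ^ 2)))
    (hP : ∀ y, HasDerivAt P (P' y) y) :
    IntegrableOn f (Set.Ici 0) ∧
      ∫ x in Set.Ici 0, f x = k / (n + 1) + (P 1 - P (Real.tanh t)) := by
  have hd : ∀ x ∈ Set.Ioi (1 : ℝ),
      HasDerivAt (fun x => P (Real.tanh (b * (x - 1) + t))) (f x) x := by
    intro x hx
    rw [hge x hx]
    exact (hP _).comp x (hasDerivAt_tanh_affine t x)
  have hc : ContinuousWithinAt (fun x => P (Real.tanh (b * (x - 1) + t))) (Set.Ici 1) 1 :=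
    ((hP _).comp 1 (hasDerivAt_tanh_affine t 1)).continuousAt.continuousWithinAt
  have hlim : Tendsto (fun x => P (Real.tanh (b * (x - 1) + t))) atTop (𝓝 (P 1)) :=
    (hP 1).continuousAt.tendsto.comp (tendsto_tanh_affine t hb)
  -- A nonnegative derivative whose primitive has a finite limit is integrable.
  have hi1 : IntegrableOn f (Set.Ioi 1) :=
    integrableOn_Ioi_deriv_of_nonneg hc hd (fun x _ => hf0 x) hlim
  have he1 := integral_Ioi_of_hasDerivAt_of_nonneg hc hd (fun x _ => hf0 x) hlim
  have hae : ∀ᵐ x ∂volume.restrict (Set.Ioc (0 : ℝ) 1), k * x ^ n = f x := by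
    have : ∀ᵐ x : ℝ, x ≠ 1 := by simp [ae_iff, measure_singleton]
    rw [ae_restrict_iff' measurableSet_Ioc]
    filter_upwards [this] with x hx hx'
    exact (hle x (lt_of_le_of_ne hx'.2 hx)).symm
  have hi0 : IntegrableOn f (Set.Ioc 0 1) := by
    refine Integrable.congr ?_ hae
    exact ((continuous_const.mul (continuous_pow n)).integrableOn_Icc).mono_set
      Set.Ioc_subset_Icc_self
  have he0 : ∫ x in Set.Ioc 0 1, f x = k / (n + 1) := by
    rw [← integral_congr_ae hae, ← intervalIntegral.integral_of_le zero_le_one,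
      intervalIntegral.integral_const_mul, integral_pow]
    simp [div_eq_mul_inv]
  have hU : Set.Ioc (0 : ℝ) 1 ∪ Set.Ioi 1 = Set.Ioi 0 := Set.Ioc_union_Ioi_eq_Ioi zero_le_one
  rw [integrableOn_Ici_iff_integrableOn_Ioi, integral_Ici_eq_integral_Ioi, ← hU]
  refine ⟨hi0.union hi1, ?_⟩
  rw [setIntegral_union (Set.Ioc_disjoint_Ioi le_rfl)
    measurableSet_Ioi hi0 hi1, he0, he1]
  simp

/-- This makes the soliton integrands polynomials in `tanh`, ready for the substitution `y = tanh`.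
-/
theorem two_mul_sq_mul_inv_cosh_sq (y : ℝ) :
    (√2 * b * (Real.cosh y)⁻¹) ^ 2 = 2 * b ^ 2 * (1 - Real.tanh y ^ 2) := by
  rw [Real.one_sub_tanh_sq, mul_pow, mul_pow, Real.sq_sqrt zero_le_two, inv_pow, one_div]

theorem integral_solitonProfile_sq (hb : 0 < b) :
    IntegrableOn (fun x => ‖solitonProfile b t x‖ ^ 2) (Set.Ici 0) ∧
      ∫ x in Set.Ici 0, ‖solitonProfile b t x‖ ^ 2 =
        2 * b ^ 2 * (1 - Real.tanh t ^ 2) / 3 + 2 * b * (1 - Real.tanh t) := by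
  have := integral_Ici_of_monomial_of_tanh t hb (f := fun x => ‖solitonProfile b t x‖ ^ 2)
    (k := 2 * b ^ 2 * (1 - Real.tanh t ^ 2)) (n := 2) (P := fun y => 2 * b * y)
    (P' := fun _ => 2 * b) (fun x => by positivity) ?_ ?_ ?_
  · refine ⟨this.1, this.2.trans ?_⟩
    push_cast
    ring
  · intro x hx
    rw [solitonProfile_of_le b t hx.le, Real.norm_eq_abs, sq_abs, mul_pow,
      two_mul_sq_mul_inv_cosh_sq]
  · intro x hx
    rw [solitonProfile_of_ge b t hx.le, Real.norm_eq_abs, sq_abs, two_mul_sq_mul_inv_cosh_sq]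
    ring
  · intro y
    simpa using (hasDerivAt_id y).const_mul (2 * b)

theorem integral_solitonProfile_pow_four (hb : 0 < b) :
    ∫ x in Set.Ici 0, ‖solitonProfile b t x‖ ^ 4 =
      (2 * b ^ 2 * (1 - Real.tanh t ^ 2)) ^ 2 / 5 +
        4 * b ^ 3 * (2 / 3 - Real.tanh t + Real.tanh t ^ 3 / 3) := by
  -- On the soliton part the fourth power is `4 b⁴ (1 - y²)²` with `y = tanh`. One factor `b (1 -
  -- y²)` is the derivative of `y`, which leaves `P'`.
  have := integral_Ici_of_monomial_of_tanh t hb (f := fun x => ‖solitonProfile b t x‖ ^ 4)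
    (k := (2 * b ^ 2 * (1 - Real.tanh t ^ 2)) ^ 2) (n := 4)
    (P := fun y => 4 * b ^ 3 * (y - y ^ 3 / 3))
    (P' := fun y => 4 * b ^ 3 * (1 - y ^ 2)) (fun x => by positivity) ?_ ?_ ?_
  · refine this.2.trans ?_
    push_cast
    ring
  · intro x hx
    rw [solitonProfile_of_le b t hx.le, Real.norm_eq_abs, Even.pow_abs (by decide), mul_pow,
      ← two_mul_sq_mul_inv_cosh_sq]
    ring
  · intro x hx
    rw [solitonProfile_of_ge b t hx.le, Real.norm_eq_abs, Even.pow_abs (by decide),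
      show 4 = 2 * 2 from rfl, pow_mul, two_mul_sq_mul_inv_cosh_sq]
    ring
  · intro y
    refine (((hasDerivAt_id y).sub (((hasDerivAt_id y).pow 3).div_const 3)).const_mul
      (4 * b ^ 3)).congr_deriv ?_
    simp

theorem integral_solitonProfileDeriv_sq (hb : 0 < b) :
    IntegrableOn (fun x => ‖solitonProfileDeriv b t x‖ ^ 2) (Set.Ici 0) ∧
      ∫ x in Set.Ici 0, ‖solitonProfileDeriv b t x‖ ^ 2 =
        2 * b ^ 2 * (1 - Real.tanh t ^ 2) + 2 * b ^ 3 / 3 * (1 - Real.tanh t ^ 3) := by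
  have := integral_Ici_of_monomial_of_tanh t hb (f := fun x => ‖solitonProfileDeriv b t x‖ ^ 2)
    (k := 2 * b ^ 2 * (1 - Real.tanh t ^ 2)) (n := 0) (P := fun y => 2 * b ^ 3 / 3 * y ^ 3)
    (P' := fun y => 2 * b ^ 3 * y ^ 2) (fun x => by positivity) ?_ ?_ ?_
  · refine ⟨this.1, this.2.trans ?_⟩
    push_cast
    ring
  · intro x hx
    rw [solitonProfileDeriv, if_pos hx, Real.norm_eq_abs, sq_abs, two_mul_sq_mul_inv_cosh_sq]
    simp
  · intro x hx
    have h := two_mul_sq_mul_inv_cosh_sq (b := b) (b * (x - 1) + t)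
    rw [solitonProfileDeriv, if_neg hx.not_gt, Real.norm_eq_abs, sq_abs]
    linear_combination (Real.tanh (b * (x - 1) + t) ^ 2 * b ^ 2) * h
  · intro y
    refine (((hasDerivAt_id y).pow 3).const_mul (2 * b ^ 3 / 3)).congr_deriv ?_
    simp
    ring

end SolitonProfile

/-! ### The upper bound and the conclusion -/

namespace MetricGraph

variable {V E : Type*} {G : MetricGraph V E}

open Filter Topology in
/-- On a non-compact graph, solitons that escape along a halfline are competitors in the limit. -/
theorem groundEnergy_le (hG : G.IsNoncompact) {μ : ℝ} (hμ : 0 < μ) :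
    G.groundEnergy μ ≤ ((-(μ ^ 3 / 96) : ℝ) : EReal) := by
  obtain ⟨e, he⟩ := hG
  -- The complete soliton `√2 b / cosh (b x)` on the line has mass `4 b`.
  set b := μ / 4 with hbdef
  have hb : 0 < b := by positivity
  have hμb : μ = 4 * b := by rw [hbdef]; ring
  let M : ℝ → ℝ := fun y => 2 * b ^ 2 * (1 - y ^ 2) / 3 + 2 * b * (1 - y)
  let A : ℝ → ℝ := fun y => 2 * b ^ 2 * (1 - y ^ 2) + 2 * b ^ 3 / 3 * (1 - y ^ 3)
  let B : ℝ → ℝ := fun y =>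
    (2 * b ^ 2 * (1 - y ^ 2)) ^ 2 / 5 + 4 * b ^ 3 * (2 / 3 - y + y ^ 3 / 3)
  -- The energy of the normalized profile depends on `t` only through `y = tanh t`. The peak sits at
  -- `1 - t / b` for `t ≤ 0`, so its escape as `t → -∞` is the limit `y → -1`, where `M y = μ` and
  -- `H` is continuous.
  let H : ℝ → ℝ := fun y => 1 / 2 * (μ / M y * A y) - 1 / 4 * ((μ / M y) ^ 2 * B y)
  have hM1 : M (-1) = 4 * b := by simp only [M]; ring
  have hA1 : A (-1) = 4 * b ^ 3 / 3 := by simp only [A]; ring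
  have hB1 : B (-1) = 16 * b ^ 3 / 3 := by simp only [B]; ring
  have hH1 : H (-1) = -(μ ^ 3 / 96) := by
    simp only [H]
    rw [hM1, hA1, hB1, hμb, div_self (by positivity)]
    ring
  have hH : ContinuousAt H (-1) := by
    have hdiv : ContinuousAt (fun y => μ / M y) (-1) :=
      continuousAt_const.div (by fun_prop) (by rw [hM1]; positivity)
    exact (continuousAt_const.mul (hdiv.mul (by fun_prop))).sub
      (continuousAt_const.mul ((hdiv.pow 2).mul (by fun_prop)))
  have hlim : Tendsto (fun t => ((H (Real.tanh t) : ℝ) : EReal)) atBot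
      (𝓝 ((-(μ ^ 3 / 96) : ℝ) : EReal)) := by
    rw [← hH1]
    exact (continuous_coe_real_ereal.tendsto _).comp (hH.tendsto.comp Real.tendsto_tanh_atBot)
  refine ge_of_tendsto' hlim fun t => ?_
  obtain ⟨K, hK⟩ := exists_lipschitzWith_solitonProfile b t
  obtain ⟨hi, hM⟩ := integral_solitonProfile_sq t hb
  obtain ⟨hi', hA⟩ := integral_solitonProfileDeriv_sq t hb
  refine groundEnergy_le_of_profile he hK ?_ ?_ hi hi' hμ ?_ hM hA
    (integral_solitonProfile_pow_four t hb)
  · rw [solitonProfile_of_le b t zero_le_one, mul_zero]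
  · refine ae_restrict_of_ae ?_
    have : ∀ᵐ x : ℝ, x ≠ 1 := by simp [ae_iff, measure_singleton]
    filter_upwards [this] with x hx using hasDerivAt_solitonProfile b t hx
  · have h1 := Real.tanh_lt_one t
    have h2 := Real.neg_one_lt_tanh t
    have : 0 < 1 - Real.tanh t ^ 2 := by nlinarith
    have : 0 < 1 - Real.tanh t := by linarith
    positivity

end MetricGraph

theorem mainTheorem3 {V E : Type*} (G : MetricGraph V E) (hG : G.IsNoncompact)
    (μ : ℝ) (hμ : 0 < μ) :
    ((-(μ ^ 3 / 24) : ℝ) : EReal) ≤ G.groundEnergy μ ∧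
      G.groundEnergy μ ≤ ((-(μ ^ 3 / 96) : ℝ) : EReal) := by
  refine ⟨le_iInf₂ fun u hu => ?_, MetricGraph.groundEnergy_le hG hμ⟩
  rw [EReal.coe_le_coe_iff, ← hu.2]
  exact hu.1.neg_le_energy hG
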